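/- For $d\ge 1$ let $\mathbb{P}(\mathbb{C}^d)=\{|v\rangle\langle v| : v\in\mathbb{C}^d,\ \langle v|v\rangle=1\}$, and let the Haar measure on $\mathbb{P}(\mathbb{C}^d)$ be the unitarily invariant probability measure induced by the Haar probability measure of $\operatorname{U}(d)$ (the law of $V\phi_0V^\dagger$ for Haar-distributed $V$ and a fixed reference state $\phi_0$). For an integer $k\ge 0$, a Borel probability measure $\mu$ on $\mathbb{P}(\mathbb{C}^d)$ is a state $k$-design if $$\mathbb{E}_{\psi\sim\mu}[\psi^{\otimes k}]=\mathbb{E}_{\phi\sim\mathrm{Haar}}[\phi^{\otimes k}],$$ and a Borel probability measure $\nu$ on $\operatorname{U}(d)$ is a unitary $k$-design if $$\mathbb{E}_{U\sim\nu}[U^{\otimes k,k}]=\mathbb{E}_{V\sim\mathrm{Haar}}[V^{\otimes k,k}],\qquad U^{\otimes k,k}:=(U^*\otimes U)^{\otimes k},$$ where $U^*$ is the entrywise complex conjugate of $U$. **Theorem.** Let $k\ge 0$ and let $\nu$ be a Borel probability measure on $\operatorname{U}(2)$ such that for every state $\psi\in\mathbb{P}(\mathbb{C}^2)$ the distribution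 $\nu_\psi$ of $U\psi U^\dagger$, $U\sim\nu$, is a state $k$-design on $\mathbb{P}(\mathbb{C}^2)$. Then $\nu$ is a unitary $k$-design. -/

import Mathlib

open MeasureTheory Matrix

/-- The `k`-fold tensor (Kronecker) power `A^{⊗k}` of a square matrix `A` over `ℂ`; its rows and
columns are labelled by the product basis, i.e. by `k`-tuples of basis labels of `A`. -/
def tensorPow {n : Type*} (A : Matrix n n ℂ) (k : ℕ) : Matrix (Fin k → n) (Fin k → n) ℂ :=
  Matrix.of fun i j => ∏ l, A (i l) (j l)

/-- `U^{⊗k,k} = (U^* ⊗ U)^{⊗k}`, where `U^*` is the entrywise complex conjugate of `U`. -/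
def tensorPowConj {n : Type*} (U : Matrix n n ℂ) (k : ℕ) :
    Matrix (Fin k → n × n) (Fin k → n × n) ℂ :=
  tensorPow (Matrix.kronecker (U.map star) U) k

/-- The expectation `𝔼_{x ∼ μ}[F x]` of a matrix-valued random variable, taken entrywise. -/
noncomputable def matrixExpectation {Ω m n : Type*} [MeasurableSpace Ω] (μ : Measure Ω)
    (F : Ω → Matrix m n ℂ) : Matrix m n ℂ :=
  Matrix.of fun i j => ∫ x, F x i j ∂μ

/-- `U(d)` is compact. -/
instance unitaryGroup_compactSpace (d : ℕ) : CompactSpace (Matrix.unitaryGroup (Fin d) ℂ) := by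
  refine isCompact_iff_compactSpace.mp ?_
  have hK : IsCompact (Set.univ.pi fun _ : Fin d => Set.univ.pi fun _ : Fin d =>
      Metric.closedBall (0 : ℂ) 1) :=
    isCompact_univ_pi fun _ => isCompact_univ_pi fun _ => isCompact_closedBall 0 1
  refine hK.of_isClosed_subset ?_ ?_
  · have hs : ((Matrix.unitaryGroup (Fin d) ℂ : Submonoid _) : Set (Matrix (Fin d) (Fin d) ℂ)) =
        {A | A * star A = 1} := by
      ext A
      exact Matrix.mem_unitaryGroup_iff
    rw [hs]
    exact isClosed_eq (by fun_prop) continuous_const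
  · intro A hA i _ j _
    simpa using entry_norm_bound_of_unitary hA i j

/-- `U(d)` carries its Borel σ-algebra. -/
noncomputable instance unitaryGroup_measurableSpace (d : ℕ) :
    MeasurableSpace (Matrix.unitaryGroup (Fin d) ℂ) :=
  borel _

instance unitaryGroup_borelSpace (d : ℕ) : BorelSpace (Matrix.unitaryGroup (Fin d) ℂ) :=
  ⟨rfl⟩

/-- The Haar measure on `U(d)`, normalized to be a probability measure. -/
noncomputable def haarUnitary (d : ℕ) : Measure (Matrix.unitaryGroup (Fin d) ℂ) :=
  Measure.haarMeasure ⊤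

instance haarUnitary_isProbabilityMeasure (d : ℕ) : IsProbabilityMeasure (haarUnitary d) :=
  ⟨Measure.haarMeasure_self (K₀ := ⊤)⟩

/-- The projective Hilbert space `ℙ(ℂ^d)`, realized as the set of rank-one projectors
`|v⟩⟨v|` with `v ∈ ℂ^d` and `⟨v|v⟩ = 1`. Its topology is the one induced
from the space of matrices. -/
abbrev PureState (d : ℕ) : Type :=
  {ρ : Matrix (Fin d) (Fin d) ℂ //
    ∃ v : Fin d → ℂ, star v ⬝ᵥ v = 1 ∧ ρ = Matrix.vecMulVec v (star v)}

/-- `ℙ(ℂ^d)` carries its Borel σ-algebra. -/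
noncomputable instance pureState_measurableSpace (d : ℕ) : MeasurableSpace (PureState d) :=
  borel _

instance pureState_borelSpace (d : ℕ) : BorelSpace (PureState d) :=
  ⟨rfl⟩

/-- The state `U ψ U†` that results from applying the unitary `U` to the state `ψ`. -/
def applyUnitary {d : ℕ} (U : Matrix.unitaryGroup (Fin d) ℂ) (ψ : PureState d) : PureState d :=
  ⟨(U : Matrix (Fin d) (Fin d) ℂ) * ψ.1 * (U : Matrix (Fin d) (Fin d) ℂ)ᴴ, by
    obtain ⟨v, hv, hψ⟩ := ψ.2
    refine ⟨(U : Matrix (Fin d) (Fin d) ℂ) *ᵥ v, ?_, ?_⟩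
    · have hU : (U : Matrix (Fin d) (Fin d) ℂ)ᴴ * (U : Matrix (Fin d) (Fin d) ℂ) = 1 :=
        Matrix.mem_unitaryGroup_iff'.mp U.2
      rw [Matrix.star_mulVec, Matrix.dotProduct_mulVec, Matrix.vecMul_vecMul, hU,
        Matrix.vecMul_one, hv]
    · rw [hψ, Matrix.star_mulVec, Matrix.mul_vecMulVec, Matrix.vecMulVec_mul]⟩

theorem measurable_applyUnitary {d : ℕ} (ψ : PureState d) :
    Measurable fun U : Matrix.unitaryGroup (Fin d) ℂ => applyUnitary U ψ := by
  have h : Continuous fun U : Matrix.unitaryGroup (Fin d) ℂ => applyUnitary U ψ :=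
    Continuous.subtype_mk ((continuous_subtype_val.mul continuous_const).mul
      (continuous_subtype_val.matrix_conjTranspose)) _
  exact h.measurable

/-- The distribution `ν_ψ` on `ℙ(ℂ^d)` of the state obtained by applying a `ν`-distributed
unitary to the fixed state `ψ`. -/
noncomputable def stateDistribution {d : ℕ} (ν : Measure (Matrix.unitaryGroup (Fin d) ℂ))
    (ψ : PureState d) : Measure (PureState d) :=
  ν.map fun U => applyUnitary U ψ

instance stateDistribution_isProbabilityMeasure {d : ℕ}
    (ν : Measure (Matrix.unitaryGroup (Fin d) ℂ)) [IsProbabilityMeasure ν] (ψ : PureState d) :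
    IsProbabilityMeasure (stateDistribution ν ψ) :=
  Measure.isProbabilityMeasure_map (measurable_applyUnitary ψ).aemeasurable

/-- The reference state `|0⟩⟨0|`. -/
def referenceState (d : ℕ) [NeZero d] : PureState d :=
  ⟨Matrix.vecMulVec (Pi.single 0 1) (star (Pi.single 0 1)), Pi.single 0 1, by simp, rfl⟩

/-- The unitarily invariant probability measure on `ℙ(ℂ^d)` induced by the Haar measure of
`U(d)`. -/
noncomputable def haarState (d : ℕ) [NeZero d] : Measure (PureState d) :=
  stateDistribution (haarUnitary d) (referenceState d)

/-- A probability measure `μ` on `ℙ(ℂ^d)` is a state `k`-design if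
`𝔼_{ψ ∼ μ}[ψ^{⊗k}] = 𝔼_{φ ∼ Haar}[φ^{⊗k}]`. -/
def IsStateDesign {d : ℕ} [NeZero d] (k : ℕ) (μ : Measure (PureState d))
    [IsProbabilityMeasure μ] : Prop :=
  matrixExpectation μ (fun ψ => tensorPow ψ.1 k) =
    matrixExpectation (haarState d) (fun φ => tensorPow φ.1 k)

/-- A probability measure `ν` on `U(d)` is a unitary `k`-design if
`𝔼_{U ∼ ν}[U^{⊗k,k}] = 𝔼_{V ∼ Haar}[V^{⊗k,k}]`. -/
def IsUnitaryDesign {d : ℕ} (k : ℕ) (ν : Measure (Matrix.unitaryGroup (Fin d) ℂ))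
    [IsProbabilityMeasure ν] : Prop :=
  matrixExpectation ν (fun U => tensorPowConj (U : Matrix (Fin d) (Fin d) ℂ) k) =
    matrixExpectation (haarUnitary d) (fun V => tensorPowConj (V : Matrix (Fin d) (Fin d) ℂ) k)

/-! Let `L` be the difference of the expectations under `ν` and Haar, on continuous functions on
`U(2)`. Write `a, b, c, d` for the entries of `U` and `δ` for the conjugate of `det U`. In dimension
two each conjugate entry is `±δ` times an entry, so the entries of `U^{⊗k,k}` are `±δ^k` times
monomials of degree `2k`, and `L` must kill all of these. The hypothesis says that `L` kills
products of `k` coordinates of `Uv` and `k` conjugate ones; contracting tensor factors gives the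
same for every `n ≤ k`. For `v = (1, z)` such products are polynomials in `z` and its conjugate, so
`L` kills each coefficient. The coefficients of extreme degree in the conjugate variable are, up to
nonzero scalars, `δ^n` times a degree-`n` monomial in one row times a degree-`n` monomial in one
column (`map_unitaryEntry_pow_mul_star_eq_zero`). The relation `δ(ad - bc) = 1` reduces every other
monomial to these, by induction on `n` (`monomial_mem_of_extremal_mem`). -/

/-! ### Reduction of monomials by the determinant relation -/

/-- Modulo `N`, a factor `ad` may be traded for `bc`: the difference is a monomial of level `n - 1`,
in `N` by induction. Trading until one letter is gone leaves a row-times-column monomial. -/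
theorem monomial_mem_of_extremal_mem {A : Type*} [CommRing A] [Algebra ℂ A] (N : Submodule ℂ A)
    {δ a b c d : A} (hδ : δ * (a * d - b * c) = 1) (k : ℕ)
    (hcb : ∀ n i q, n ≤ k → i ≤ n → q ≤ n →
      δ ^ n * (c ^ (n - i) * d ^ i * (d ^ q * b ^ (n - q))) ∈ N)
    (hca : ∀ n i q, n ≤ k → i ≤ n → q ≤ n →
      δ ^ n * (c ^ (n - i) * d ^ i * (c ^ q * a ^ (n - q))) ∈ N)
    (hab : ∀ n i q, n ≤ k → i ≤ n → q ≤ n →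
      δ ^ n * (a ^ (n - i) * b ^ i * (d ^ q * b ^ (n - q))) ∈ N)
    (haa : ∀ n i q, n ≤ k → i ≤ n → q ≤ n →
      δ ^ n * (a ^ (n - i) * b ^ i * (c ^ q * a ^ (n - q))) ∈ N)
    (n : ℕ) (hn : n ≤ k) (e₁ e₂ e₃ e₄ : ℕ) (he : e₁ + e₂ + e₃ + e₄ = 2 * n) :
    δ ^ n * (a ^ e₁ * b ^ e₂ * c ^ e₃ * d ^ e₄) ∈ N := by
  have key : ∀ n ≤ k, (∀ t e₁ e₂ e₃ e₄ : ℕ, e₁ + e₂ + e₃ + e₄ + 2 * t = 2 * n →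
      (δ ^ n * (a ^ (e₁ + t) * b ^ e₂ * c ^ e₃ * d ^ (e₄ + t)) ∈ N ↔
        δ ^ n * (a ^ e₁ * b ^ (e₂ + t) * c ^ (e₃ + t) * d ^ e₄) ∈ N)) →
      ∀ e₁ e₂ e₃ e₄ : ℕ, e₁ + e₂ + e₃ + e₄ = 2 * n →
        δ ^ n * (a ^ e₁ * b ^ e₂ * c ^ e₃ * d ^ e₄) ∈ N := by
    intro n hn swap e₁ e₂ e₃ e₄ he
    -- Trades preserve `e₁ + e₂` and `e₁ + e₃`. Comparing these with `n` decides which letter can be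
    -- removed: `a`, `b`, `c`, `d` in the four cases.
    rcases le_total (e₁ + e₂) n with h1 | h1 <;> rcases le_total (e₁ + e₃) n with h2 | h2
    · have h := (swap e₁ 0 e₂ e₃ (e₄ - e₁) (by omega)).2
        (by
          convert hcb n (n - (e₁ + e₃)) (n - (e₁ + e₂)) hn (by omega) (by omega) using 2
          rw [show n - (n - (e₁ + e₃)) = e₃ + e₁ by omega,
            show n - (n - (e₁ + e₂)) = e₂ + e₁ by omega,
            show e₄ - e₁ = (n - (e₁ + e₃)) + (n - (e₁ + e₂)) by omega]
          ring)
      rwa [zero_add, Nat.sub_add_cancel (by omega)] at h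
    · have h := (swap e₂ e₁ 0 (e₃ - e₂) e₄ (by omega)).1
        (by
          convert hca n (e₄ + e₂) (n - (e₁ + e₂)) hn (by omega) (by omega) using 2
          rw [show n - (n - (e₁ + e₂)) = e₁ + e₂ by omega,
            show e₃ - e₂ = (n - (e₄ + e₂)) + (n - (e₁ + e₂)) by omega]
          ring)
      rwa [zero_add, Nat.sub_add_cancel (by omega)] at h
    · have h := (swap e₃ e₁ (e₂ - e₃) 0 e₄ (by omega)).1
        (by
          convert hab n (n - (e₁ + e₃)) (e₄ + e₃) hn (by omega) (by omega) using 2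
          rw [show n - (n - (e₁ + e₃)) = e₁ + e₃ by omega,
            show e₂ - e₃ = (n - (e₁ + e₃)) + (n - (e₄ + e₃)) by omega]
          ring)
      rwa [zero_add, Nat.sub_add_cancel (by omega)] at h
    · have h := (swap e₄ (e₁ - e₄) e₂ e₃ 0 (by omega)).2
        (by
          convert haa n (e₂ + e₄) (e₃ + e₄) hn (by omega) (by omega) using 2
          rw [show e₁ - e₄ = (n - (e₂ + e₄)) + (n - (e₃ + e₄)) by omega]
          ring)
      rwa [zero_add, Nat.sub_add_cancel (by omega)] at h
  induction n generalizing e₁ e₂ e₃ e₄ with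
  | zero =>
    refine key 0 hn (fun t e₁ e₂ e₃ e₄ h => ?_) e₁ e₂ e₃ e₄ he
    obtain rfl : t = 0 := by omega
    simp
  | succ n ih =>
    refine key (n + 1) hn (fun t => ?_) e₁ e₂ e₃ e₄ he
    induction t with
    | zero => simp
    | succ t iht =>
      intro f₁ f₂ f₃ f₄ hf
      have h1 := iht (f₁ + 1) f₂ f₃ (f₄ + 1) (by omega)
      have h2 := ih (by omega) f₁ (f₂ + t) (f₃ + t) f₄ (by omega)
      -- One more trade changes the element by exactly the level-`n` monomial in `h2`.
      rw [show f₁ + (t + 1) = f₁ + 1 + t by ring, show f₄ + (t + 1) = f₄ + 1 + t by ring, h1,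
        ← N.add_mem_iff_left (N.neg_mem h2)]
      convert Iff.rfl using 2
      linear_combination -(δ ^ n * (a ^ f₁ * b ^ (f₂ + t) * c ^ (f₃ + t) * d ^ f₄)) * hδ

/-! ### Independence of `z` and its conjugate -/

theorem coeff_eq_zero_of_sum_pow_mul_conj_pow_eq_zero (m n : ℕ) (c : ℕ → ℕ → ℂ)
    (h : ∀ z : ℂ, ∑ i ∈ Finset.range m, ∑ j ∈ Finset.range n,
      c i j * (z ^ i * (star z) ^ j) = 0) (i j : ℕ) (hi : i < m) (hj : j < n) : c i j = 0 := by
  classical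
  let e : ℕ → ℕ → (Fin 2 →₀ ℕ) := fun i j => Finsupp.single 0 i + Finsupp.single 1 j
  let p : MvPolynomial (Fin 2) ℂ := ∑ i ∈ Finset.range m, ∑ j ∈ Finset.range n,
    MvPolynomial.C (c i j) * (MvPolynomial.X 0 ^ i * MvPolynomial.X 1 ^ j)
  -- With `z = u + iv`, the substituted polynomial vanishes at all real `(u, v)`, hence identically;
  -- the linear change of variables is invertible over `ℂ`.
  let s : Fin 2 → MvPolynomial (Fin 2) ℂ :=
    ![MvPolynomial.X 0 + MvPolynomial.C Complex.I * MvPolynomial.X 1,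
      MvPolynomial.X 0 - MvPolynomial.C Complex.I * MvPolynomial.X 1]
  have hs : MvPolynomial.bind₁ s p = 0 := by
    refine MvPolynomial.funext_set (fun _ => Set.range Complex.ofReal)
      (fun _ => Set.infinite_range_of_injective Complex.ofReal_injective) fun x hx => ?_
    obtain ⟨u, hu⟩ := hx 0 (Set.mem_univ _)
    obtain ⟨v, hv⟩ := hx 1 (Set.mem_univ _)
    have := h (u + Complex.I * v)
    simpa [p, s, ← hu, ← hv, sub_eq_add_neg] using this
  have hp : p = 0 := by
    refine MvPolynomial.funext fun x => ?_
    have := congrArg (MvPolynomial.eval ![(x 0 + x 1) / 2, (x 0 - x 1) / (2 * Complex.I)]) hs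
    have h0 : (x 0 + x 1) / 2 + Complex.I * ((x 0 - x 1) / (2 * Complex.I)) = x 0 := by
      field_simp; ring
    have h1 : (x 0 + x 1) / 2 - Complex.I * ((x 0 - x 1) / (2 * Complex.I)) = x 1 := by
      field_simp; ring
    simpa [p, s, h0, h1] using this
  have hc := congrArg (MvPolynomial.coeff (e i j)) hp
  have hmon : ∀ i j : ℕ, (MvPolynomial.X 0 ^ i * MvPolynomial.X 1 ^ j : MvPolynomial (Fin 2) ℂ) =
      MvPolynomial.monomial (e i j) 1 := by
    intro i j
    simp [e, MvPolynomial.X_pow_eq_monomial, MvPolynomial.monomial_mul]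
  have he : ∀ i' j', e i' j' = e i j ↔ i' = i ∧ j' = j := by
    intro i' j'
    refine ⟨fun h => ⟨?_, ?_⟩, fun h => by rw [h.1, h.2]⟩
    · simpa [e] using DFunLike.congr_fun h 0
    · simpa [e] using DFunLike.congr_fun h 1
  simp only [p, hmon, MvPolynomial.coeff_sum, MvPolynomial.coeff_C_mul, MvPolynomial.coeff_monomial,
    he, MvPolynomial.coeff_zero] at hc
  rw [Finset.sum_eq_single i, Finset.sum_eq_single j] at hc
  · simpa using hc
  · intro j' _ hne; simp [hne]
  · intro hne; simp at hne; omega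
  · intro i' _ hne; simp [hne]
  · intro hne; simp at hne; omega

open Polynomial in
theorem map_coeff_mul_coeff_eq_zero {A : Type*} [CommRing A] [Algebra ℂ A] (L : A →ₗ[ℂ] ℂ)
    (P Q : A[X])
    (h : ∀ z : ℂ, L (P.eval (algebraMap ℂ A z) * Q.eval (algebraMap ℂ A (star z))) = 0)
    (i j : ℕ) : L (P.coeff i * Q.coeff j) = 0 := by
  by_cases hi : i < P.natDegree + 1
  swap
  · rw [P.coeff_eq_zero_of_natDegree_lt (by omega)]; simp
  by_cases hj : j < Q.natDegree + 1
  swap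
  · rw [Q.coeff_eq_zero_of_natDegree_lt (by omega)]; simp
  refine coeff_eq_zero_of_sum_pow_mul_conj_pow_eq_zero _ _ (fun i j => L (P.coeff i * Q.coeff j))
    (fun z => ?_) i j hi hj
  rw [← h z, eval_eq_sum_range, eval_eq_sum_range, Finset.sum_mul_sum, map_sum]
  refine Finset.sum_congr rfl fun i _ => ?_
  rw [map_sum]
  refine Finset.sum_congr rfl fun j _ => ?_
  have : P.coeff i * algebraMap ℂ A z ^ i * (Q.coeff j * algebraMap ℂ A (star z) ^ j) =
      (z ^ i * (star z) ^ j) • (P.coeff i * Q.coeff j) := by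
    rw [Algebra.smul_def, map_mul, map_pow, map_pow]; ring
  rw [this, map_smul, smul_eq_mul, mul_comm]

/-! ### Invariance of Haar measure and of its orbits -/

instance haarUnitary_isHaarMeasure (d : ℕ) : (haarUnitary d).IsHaarMeasure := by
  unfold haarUnitary; infer_instance

/-- A right translate is still left-invariant, so uniqueness makes it a multiple of Haar measure;
total mass fixes the factor. -/
theorem haarUnitary_map_mul_right {d : ℕ} (V : unitaryGroup (Fin d) ℂ) :
    (haarUnitary d).map (· * V) = haarUnitary d := by
  have : IsProbabilityMeasure ((haarUnitary d).map (· * V)) :=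
    Measure.isProbabilityMeasure_map (measurable_mul_const V).aemeasurable
  have h := Measure.isMulInvariant_eq_smul_of_compactSpace ((haarUnitary d).map (· * V))
    (haarUnitary d)
  have h1 := congrArg (fun μ : Measure _ => μ Set.univ) h
  simp only [measure_univ, Measure.smul_apply, ENNReal.smul_def, smul_eq_mul, mul_one] at h1
  rw [h, ENNReal.coe_eq_one.1 h1.symm, one_smul]

theorem applyUnitary_applyUnitary {d : ℕ} (U V : unitaryGroup (Fin d) ℂ) (ψ : PureState d) :
    applyUnitary U (applyUnitary V ψ) = applyUnitary (U * V) ψ := by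
  apply Subtype.ext
  simp [applyUnitary, Matrix.mul_assoc]

theorem stateDistribution_haarUnitary_applyUnitary {d : ℕ} (V : unitaryGroup (Fin d) ℂ)
    (ψ : PureState d) :
    stateDistribution (haarUnitary d) (applyUnitary V ψ) = stateDistribution (haarUnitary d) ψ := by
  unfold stateDistribution
  nth_rewrite 2 [← haarUnitary_map_mul_right V]
  rw [Measure.map_map (measurable_applyUnitary ψ) (measurable_mul_const V)]
  simp only [applyUnitary_applyUnitary, Function.comp_def]

theorem exists_applyUnitary_referenceState_eq (ψ : PureState 2) :
    ∃ V, applyUnitary V (referenceState 2) = ψ := by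
  obtain ⟨v, hv, hψ⟩ := ψ.2
  have hv' : star (v 0) * v 0 + star (v 1) * v 1 = 1 := by simpa [dotProduct] using hv
  -- The matrix in `SU(2)` with first column `v`.
  have hV : !![v 0, -star (v 1); v 1, star (v 0)] ∈ unitaryGroup (Fin 2) ℂ := by
    rw [mem_unitaryGroup_iff']
    ext i j
    fin_cases i <;> fin_cases j <;>
      simp [Matrix.mul_apply, Matrix.star_apply] <;> simp at hv' <;>
        first | linear_combination hv' | ring
  refine ⟨⟨_, hV⟩, Subtype.ext ?_⟩
  simp only [applyUnitary, referenceState]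
  rw [hψ, mul_vecMulVec, vecMulVec_mul, ← star_mulVec]
  have hcol : !![v 0, -star (v 1); v 1, star (v 0)] *ᵥ Pi.single 0 1 = v := by
    ext i
    fin_cases i <;> simp
  rw [hcol]

theorem stateDistribution_haarUnitary (ψ : PureState 2) :
    stateDistribution (haarUnitary 2) ψ = haarState 2 := by
  obtain ⟨V, rfl⟩ := exists_applyUnitary_referenceState_eq ψ
  exact stateDistribution_haarUnitary_applyUnitary V _

/-! ### The discrepancy functional on orbit coordinates -/

/-- The matrix entry `U ↦ U i j` as a continuous function on the unitary group. -/
def unitaryEntry {d : ℕ} (i j : Fin d) : C(unitaryGroup (Fin d) ℂ, ℂ) :=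
  ⟨fun U => (U : Matrix (Fin d) (Fin d) ℂ) i j, continuous_subtype_val.matrix_elem i j⟩

/-- The coordinate `U ↦ (U v) i` as a continuous function on the unitary group. -/
noncomputable def orbitCoord {d : ℕ} (v : Fin d → ℂ) (i : Fin d) : C(unitaryGroup (Fin d) ℂ, ℂ) :=
  ∑ j, v j • unitaryEntry i j

/-- The linear functional `f ↦ 𝔼_ν[f] - 𝔼_Haar[f]` on continuous functions. -/
noncomputable def haarDiscrepancy {d : ℕ} (ν : Measure (unitaryGroup (Fin d) ℂ))
    [IsFiniteMeasure ν] : C(unitaryGroup (Fin d) ℂ, ℂ) →ₗ[ℂ] ℂ where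
  toFun f := ∫ U, f U ∂ν - ∫ U, f U ∂haarUnitary d
  map_add' f g := by
    have hi : ∀ (μ : Measure (unitaryGroup (Fin d) ℂ)) [IsFiniteMeasure μ]
        (f : C(unitaryGroup (Fin d) ℂ, ℂ)), Integrable f μ := fun μ _ f =>
      f.continuous.integrable_of_hasCompactSupport (HasCompactSupport.of_compactSpace f)
    simp only [ContinuousMap.add_apply]
    rw [integral_add (hi _ _) (hi _ _), integral_add (hi _ _) (hi _ _)]
    ring
  map_smul' t f := by
    simp only [ContinuousMap.smul_apply, integral_smul, RingHom.id_apply, smul_sub]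

theorem orbitCoord_apply {d : ℕ} (v : Fin d → ℂ) (i : Fin d) (U : unitaryGroup (Fin d) ℂ) :
    orbitCoord v i U = ((U : Matrix (Fin d) (Fin d) ℂ) *ᵥ v) i := by
  simp [orbitCoord, unitaryEntry, mulVec, dotProduct, mul_comm, ContinuousMap.sum_apply]

theorem orbitCoord_smul {d : ℕ} (t : ℂ) (v : Fin d → ℂ) (i : Fin d) :
    orbitCoord (t • v) i = t • orbitCoord v i := by
  simp [orbitCoord, Finset.smul_sum, mul_smul]

theorem sum_orbitCoord_mul_star {d : ℕ} (v : Fin d → ℂ) :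
    ∑ i, orbitCoord v i * star (orbitCoord v i) = algebraMap ℂ _ (star v ⬝ᵥ v) := by
  ext U
  have hU : (U : Matrix (Fin d) (Fin d) ℂ)ᴴ * (U : Matrix (Fin d) (Fin d) ℂ) = 1 :=
    mem_unitaryGroup_iff'.mp U.2
  have : star ((U : Matrix (Fin d) (Fin d) ℂ) *ᵥ v) ⬝ᵥ ((U : Matrix (Fin d) (Fin d) ℂ) *ᵥ v) =
      star v ⬝ᵥ v := by
    rw [star_mulVec, dotProduct_mulVec, vecMul_vecMul, hU, vecMul_one]
  simp only [ContinuousMap.sum_apply, ContinuousMap.mul_apply, ContinuousMap.star_apply,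
    orbitCoord_apply, algebraMap_apply, ← this, smul_eq_mul, mul_one]
  exact Finset.sum_congr rfl fun i _ => mul_comm _ _

theorem matrixExpectation_stateDistribution {d k : ℕ} (ν : Measure (unitaryGroup (Fin d) ℂ))
    (ψ : PureState d) (v : Fin d → ℂ) (hψ : ψ.1 = vecMulVec v (star v)) (a b : Fin k → Fin d) :
    matrixExpectation (stateDistribution ν ψ) (fun ψ => tensorPow ψ.1 k) a b =
      ∫ U, (∏ l, orbitCoord v (a l) * star (orbitCoord v (b l))) U ∂ν := by
  have hc : Continuous fun ψ : PureState d => ∏ l, ψ.1 (a l) (b l) :=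
    continuous_finsetProd _ fun l _ => continuous_subtype_val.matrix_elem (a l) (b l)
  simp only [matrixExpectation, tensorPow, Matrix.of_apply, stateDistribution]
  rw [integral_map (measurable_applyUnitary ψ).aemeasurable hc.aestronglyMeasurable]
  congr 1
  ext U
  rw [ContinuousMap.prod_apply]
  refine Finset.prod_congr rfl fun l _ => ?_
  simp [applyUnitary, hψ, mul_vecMulVec, vecMulVec_mul, ← star_mulVec, vecMulVec_apply,
    orbitCoord_apply]

theorem haarDiscrepancy_orbit_eq_zero_of_isStateDesign {k : ℕ}
    (ν : Measure (unitaryGroup (Fin 2) ℂ)) [IsProbabilityMeasure ν]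
    (hν : ∀ ψ : PureState 2, IsStateDesign k (stateDistribution ν ψ)) (v : Fin 2 → ℂ)
    (hv : star v ⬝ᵥ v = 1) (a b : Fin k → Fin 2) :
    haarDiscrepancy ν (∏ l, orbitCoord v (a l) * star (orbitCoord v (b l))) = 0 := by
  let ψ : PureState 2 := ⟨vecMulVec v (star v), v, hv, rfl⟩
  have h := congrFun (congrFun (hν ψ) a) b
  rw [← stateDistribution_haarUnitary ψ, matrixExpectation_stateDistribution ν ψ v rfl,
    matrixExpectation_stateDistribution _ ψ v rfl] at h
  exact sub_eq_zero.2 h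

/-- Contract one tensor factor: the squared moduli of the coordinates of `Uv` sum to `1`. -/
theorem haarDiscrepancy_orbit_eq_zero_of_succ {d n : ℕ} (ν : Measure (unitaryGroup (Fin d) ℂ))
    [IsFiniteMeasure ν] (v : Fin d → ℂ) (hv : star v ⬝ᵥ v = 1)
    (h : ∀ a b : Fin (n + 1) → Fin d,
      haarDiscrepancy ν (∏ l, orbitCoord v (a l) * star (orbitCoord v (b l))) = 0)
    (a b : Fin n → Fin d) :
    haarDiscrepancy ν (∏ l, orbitCoord v (a l) * star (orbitCoord v (b l))) = 0 := by
  have h1 : ∑ i : Fin d, haarDiscrepancy ν (∏ l, orbitCoord v ((Fin.cons i a : Fin (n + 1) → _) l) *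
      star (orbitCoord v ((Fin.cons i b : Fin (n + 1) → _) l))) = 0 :=
    Finset.sum_eq_zero fun i _ => h _ _
  simpa [← map_sum, Fin.prod_univ_succ, ← Finset.sum_mul, sum_orbitCoord_mul_star, hv] using h1

/-- Contraction descends from `k` to `n`, and homogeneity drops the normalization, so that the
polynomial family `(1, z)` is allowed. -/
theorem haarDiscrepancy_orbit_eq_zero {d n k : ℕ} (hn : n ≤ k)
    (ν : Measure (unitaryGroup (Fin d) ℂ)) [IsFiniteMeasure ν]
    (h : ∀ v : Fin d → ℂ, star v ⬝ᵥ v = 1 → ∀ a b : Fin k → Fin d,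
      haarDiscrepancy ν (∏ l, orbitCoord v (a l) * star (orbitCoord v (b l))) = 0)
    (v : Fin d → ℂ) (hv : v ≠ 0) (a b : Fin n → Fin d) :
    haarDiscrepancy ν (∏ l, orbitCoord v (a l) * star (orbitCoord v (b l))) = 0 := by
  have hunit : ∀ v : Fin d → ℂ, star v ⬝ᵥ v = 1 → ∀ a b : Fin n → Fin d,
      haarDiscrepancy ν (∏ l, orbitCoord v (a l) * star (orbitCoord v (b l))) = 0 :=
    Nat.decreasingInduction
      (motive := fun n _ => ∀ v : Fin d → ℂ, star v ⬝ᵥ v = 1 → ∀ a b : Fin n → Fin d,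
        haarDiscrepancy ν (∏ l, orbitCoord v (a l) * star (orbitCoord v (b l))) = 0)
      (fun n _ ih v hv => haarDiscrepancy_orbit_eq_zero_of_succ ν v hv (ih v hv)) h hn
  have hnorm : star v ⬝ᵥ v = ((∑ i, ‖v i‖ ^ 2 : ℝ) : ℂ) := by
    simp [dotProduct, Complex.conj_mul']
  have hpos : 0 < ∑ i, ‖v i‖ ^ 2 := by
    obtain ⟨i, hi⟩ := Function.ne_iff.1 hv
    exact Finset.sum_pos' (fun i _ => by positivity) ⟨i, Finset.mem_univ _, by
      have : 0 < ‖v i‖ := norm_pos_iff.2 hi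
      positivity⟩
  set s : ℝ := Real.sqrt (∑ i, ‖v i‖ ^ 2) with hs
  have hs0 : (s : ℂ) ≠ 0 := by exact_mod_cast (Real.sqrt_pos.2 hpos).ne'
  have hw : star ((s : ℂ)⁻¹ • v) ⬝ᵥ ((s : ℂ)⁻¹ • v) = 1 := by
    rw [star_smul, smul_dotProduct, dotProduct_smul, hnorm, ← Real.sq_sqrt hpos.le, ← hs]
    simp only [star_inv₀, smul_eq_mul, Complex.star_def, Complex.conj_ofReal, Complex.ofReal_pow]
    field_simp
  have hvw : v = (s : ℂ) • ((s : ℂ)⁻¹ • v) := by rw [smul_smul, mul_inv_cancel₀ hs0, one_smul]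
  rw [hvw]
  simp only [orbitCoord_smul (s : ℂ), star_smul, smul_mul_smul_comm]
  rw [Finset.prod_smul, map_smul, hunit _ hw, smul_zero]

/-! ### Coefficients of products of linear forms -/

open Polynomial in
theorem coeff_C_add_C_mul_X_pow {A : Type*} [CommRing A] (a b : A) (n i : ℕ) (hi : i ≤ n) :
    ((C a + C b * X) ^ n).coeff i = n.choose i • (a ^ (n - i) * b ^ i) := by
  have h : (C a + C b * X) ^ n = ∑ m ∈ Finset.range (n + 1),
      C (n.choose m • (a ^ (n - m) * b ^ m)) * X ^ m := by
    rw [add_comm, add_pow]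
    refine Finset.sum_congr rfl fun m _ => ?_
    simp only [nsmul_eq_mul, map_mul, map_pow, map_natCast]
    ring
  rw [h, finsetSum_coeff]
  simp only [coeff_C_mul_X_pow]
  rw [Finset.sum_ite_eq, if_pos (Finset.mem_range.2 (by omega))]

open Polynomial in
theorem coeff_zero_C_add_C_mul_X_pow_mul {A : Type*} [CommRing A] (a b c d : A) (p q : ℕ) :
    ((C a + C b * X) ^ p * (C c + C d * X) ^ q).coeff 0 = a ^ p * c ^ q := by
  simp [coeff_zero_eq_eval_zero]

open Polynomial in
theorem coeff_add_C_add_C_mul_X_pow_mul {A : Type*} [CommRing A] (a b c d : A) (p q : ℕ) :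
    ((C a + C b * X) ^ p * (C c + C d * X) ^ q).coeff (p + q) = b ^ p * d ^ q := by
  have h : ∀ (a b : A) (p : ℕ), ((C a + C b * X) ^ p).natDegree ≤ p := fun a b p => by
    simpa using natDegree_pow_le_of_le p (m := 1) (p := C a + C b * X) (by compute_degree)
  rw [coeff_mul_add_eq_of_natDegree_le (h a b p) (h c d q), coeff_C_add_C_mul_X_pow _ _ _ _ le_rfl,
    coeff_C_add_C_mul_X_pow _ _ _ _ le_rfl]
  simp

/-! ### Conjugate entries through the adjugate -/

/-- The conjugate determinant `U ↦ star (det U)` as a continuous function on `U(2)`. -/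
noncomputable def conjDet : C(unitaryGroup (Fin 2) ℂ, ℂ) :=
  star (unitaryEntry 0 0 * unitaryEntry 1 1 - unitaryEntry 0 1 * unitaryEntry 1 0)

theorem conjDet_mul_det :
    conjDet * (unitaryEntry 0 0 * unitaryEntry 1 1 - unitaryEntry 0 1 * unitaryEntry 1 0) = 1 := by
  ext U
  have h := Unitary.star_mul_self_of_mem (det_of_mem_unitary U.2)
  rw [det_fin_two] at h
  exact h

/-- The adjoint of `U` is its inverse, and the inverse of the determinant is its conjugate. -/
theorem star_coe_eq_conjDet_smul_adjugate (U : unitaryGroup (Fin 2) ℂ) :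
    star (U : Matrix (Fin 2) (Fin 2) ℂ) =
      conjDet U • (U : Matrix (Fin 2) (Fin 2) ℂ).adjugate := by
  have h1 : star (U : Matrix (Fin 2) (Fin 2) ℂ) * (U : Matrix (Fin 2) (Fin 2) ℂ) = 1 :=
    mem_unitaryGroup_iff'.mp U.2
  have h2 : conjDet U * (U : Matrix (Fin 2) (Fin 2) ℂ).det = 1 := by
    rw [det_fin_two]
    exact DFunLike.congr_fun conjDet_mul_det U
  calc star (U : Matrix (Fin 2) (Fin 2) ℂ)
      = star (U : Matrix (Fin 2) (Fin 2) ℂ) *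
          ((conjDet U * (U : Matrix (Fin 2) (Fin 2) ℂ).det) • 1) := by rw [h2, one_smul, mul_one]
    _ = conjDet U • (star (U : Matrix (Fin 2) (Fin 2) ℂ) * (U : Matrix (Fin 2) (Fin 2) ℂ) *
          (U : Matrix (Fin 2) (Fin 2) ℂ).adjugate) := by
        rw [mul_smul, ← mul_adjugate, mul_smul_comm, Matrix.mul_assoc]
    _ = _ := by rw [h1, one_mul]

theorem star_unitaryEntry_zero_zero :
    star (unitaryEntry 0 0) = conjDet * unitaryEntry 1 1 := by
  ext U
  simpa [unitaryEntry, adjugate_fin_two, Matrix.star_apply] using congrFun (congrFun (star_coe_eq_conjDet_smul_adjugate U) 0) 0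

theorem star_unitaryEntry_zero_one :
    star (unitaryEntry 0 1) = -(conjDet * unitaryEntry 1 0) := by
  ext U
  simpa [unitaryEntry, adjugate_fin_two, Matrix.star_apply] using congrFun (congrFun (star_coe_eq_conjDet_smul_adjugate U) 1) 0

theorem star_unitaryEntry_one_zero :
    star (unitaryEntry 1 0) = -(conjDet * unitaryEntry 0 1) := by
  ext U
  simpa [unitaryEntry, adjugate_fin_two, Matrix.star_apply] using congrFun (congrFun (star_coe_eq_conjDet_smul_adjugate U) 0) 1

theorem star_unitaryEntry_one_one :
    star (unitaryEntry 1 1) = conjDet * unitaryEntry 0 0 := by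
  ext U
  simpa [unitaryEntry, adjugate_fin_two, Matrix.star_apply] using congrFun (congrFun (star_coe_eq_conjDet_smul_adjugate U) 1) 1

/-! ### Row-times-column monomials and the conclusion -/

open Polynomial in
theorem map_unitaryEntry_pow_mul_star_eq_zero {n : ℕ}
    (L : C(unitaryGroup (Fin 2) ℂ, ℂ) →ₗ[ℂ] ℂ)
    (hL : ∀ v : Fin 2 → ℂ, v ≠ 0 → ∀ a b : Fin n → Fin 2,
      L (∏ l, orbitCoord v (a l) * star (orbitCoord v (b l))) = 0)
    (r s : Fin 2) {i q : ℕ} (hi : i ≤ n) (hq : q ≤ n) :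
    L (unitaryEntry r 0 ^ (n - i) * unitaryEntry r 1 ^ i *
      (star (unitaryEntry 0 s) ^ q * star (unitaryEntry 1 s) ^ (n - q))) = 0 := by
  let P : C(unitaryGroup (Fin 2) ℂ, ℂ)[X] := (C (unitaryEntry r 0) + C (unitaryEntry r 1) * X) ^ n
  let Q : C(unitaryGroup (Fin 2) ℂ, ℂ)[X] :=
    (C (star (unitaryEntry 0 0)) + C (star (unitaryEntry 0 1)) * X) ^ q *
      (C (star (unitaryEntry 1 0)) + C (star (unitaryEntry 1 1)) * X) ^ (n - q)
  have hPQ : ∀ j, L (P.coeff i * Q.coeff j) = 0 := by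
    intro j
    refine map_coeff_mul_coeff_eq_zero L P Q (fun z => ?_) i j
    have ho : ∀ t : Fin 2, orbitCoord ![1, z] t =
        unitaryEntry t 0 + unitaryEntry t 1 * algebraMap ℂ _ z := by
      intro t
      rw [mul_comm, ← Algebra.smul_def]
      simp [orbitCoord]
    have hs : ∀ t : Fin 2, star (orbitCoord ![1, z] t) =
        star (unitaryEntry t 0) + star (unitaryEntry t 1) * algebraMap ℂ _ (star z) := by
      intro t
      rw [ho, star_add, star_mul', algebraMap_star_comm]
    have h := hL ![1, z] (fun h => one_ne_zero (congrFun h 0)) (fun _ => r)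
      (fun l => if (l : ℕ) < q then 0 else 1)
    rw [← h]
    congr 1
    rw [Finset.prod_mul_distrib, Fin.prod_const,
      Fin.prod_univ_eq_prod_range (fun l => star (orbitCoord ![1, z] (if l < q then 0 else 1))) n,
      ← Finset.prod_range_mul_prod_Ico _ hq,
      Finset.prod_congr rfl (g := fun _ => star (orbitCoord ![1, z] 0))
        (fun l hl => by rw [if_pos (Finset.mem_range.1 hl)]),
      Finset.prod_congr (s₁ := Finset.Ico q n) rfl (g := fun _ => star (orbitCoord ![1, z] 1))
        (fun l hl => by rw [if_neg (by have := Finset.mem_Ico.1 hl; omega)]),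
      Finset.prod_const, Finset.prod_const, Finset.card_range, Nat.card_Ico, hs, hs, ho]
    simp [P, Q]
  -- Only the lowest and highest coefficients of `Q` are single monomials; they select column `0` or
  -- column `1`.
  have hQ : ∃ j, Q.coeff j = star (unitaryEntry 0 s) ^ q * star (unitaryEntry 1 s) ^ (n - q) := by
    fin_cases s
    · exact ⟨0, coeff_zero_C_add_C_mul_X_pow_mul _ _ _ _ _ _⟩
    · exact ⟨q + (n - q), coeff_add_C_add_C_mul_X_pow_mul _ _ _ _ _ _⟩
  obtain ⟨j, hj⟩ := hQ
  have h := hPQ j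
  rw [hj, coeff_C_add_C_mul_X_pow _ _ _ _ hi, smul_mul_assoc, map_nsmul] at h
  exact (smul_eq_zero.1 h).resolve_left (Nat.choose_pos hi).ne'

theorem exists_prod_eq_smul_conjDet_pow_mul {n : ℕ} (i j : Fin n → Fin 2 × Fin 2) :
    ∃ (t : ℂ) (e₁ e₂ e₃ e₄ : ℕ), e₁ + e₂ + e₃ + e₄ = 2 * n ∧
      ∏ l, star (unitaryEntry (i l).1 (j l).1) * unitaryEntry (i l).2 (j l).2 =
        t • (conjDet ^ n * (unitaryEntry 0 0 ^ e₁ * unitaryEntry 0 1 ^ e₂ *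
          unitaryEntry 1 0 ^ e₃ * unitaryEntry 1 1 ^ e₄)) := by
  have hentry : ∀ r s : Fin 2, ∃ e₁ e₂ e₃ e₄ : ℕ, e₁ + e₂ + e₃ + e₄ = 1 ∧
      unitaryEntry r s = unitaryEntry 0 0 ^ e₁ * unitaryEntry 0 1 ^ e₂ *
          unitaryEntry 1 0 ^ e₃ * unitaryEntry 1 1 ^ e₄ := by
    intro r s
    fin_cases r <;> fin_cases s
    · exact ⟨1, 0, 0, 0, rfl, by simp⟩
    · exact ⟨0, 1, 0, 0, rfl, by simp⟩
    · exact ⟨0, 0, 1, 0, rfl, by simp⟩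
    · exact ⟨0, 0, 0, 1, rfl, by simp⟩
  have hstar : ∀ r s : Fin 2, ∃ (t : ℂ) (r' s' : Fin 2),
      star (unitaryEntry r s) = t • (conjDet * unitaryEntry r' s') := by
    intro r s
    fin_cases r <;> fin_cases s
    · exact ⟨1, 1, 1, by rw [one_smul]; exact star_unitaryEntry_zero_zero⟩
    · exact ⟨-1, 1, 0, by rw [neg_one_smul]; exact star_unitaryEntry_zero_one⟩
    · exact ⟨-1, 0, 1, by rw [neg_one_smul]; exact star_unitaryEntry_one_zero⟩
    · exact ⟨1, 0, 0, by rw [one_smul]; exact star_unitaryEntry_one_one⟩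
  induction n with
  | zero => exact ⟨1, 0, 0, 0, 0, rfl, by simp⟩
  | succ n ih =>
    obtain ⟨t, e₁, e₂, e₃, e₄, he, h⟩ := ih (fun l => i l.succ) (fun l => j l.succ)
    obtain ⟨t', r, s, h'⟩ := hstar (i 0).1 (j 0).1
    obtain ⟨f₁, f₂, f₃, f₄, hf, hrs⟩ := hentry r s
    obtain ⟨g₁, g₂, g₃, g₄, hg, h0⟩ := hentry (i 0).2 (j 0).2
    refine ⟨t' * t, f₁ + g₁ + e₁, f₂ + g₂ + e₂, f₃ + g₃ + e₃, f₄ + g₄ + e₄, by omega, ?_⟩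
    rw [Fin.prod_univ_succ, h, h', h0, hrs, smul_mul_assoc, smul_mul_smul_comm]
    congr 1
    ring

theorem theoremA1 (k : ℕ) (ν : MeasureTheory.Measure (Matrix.unitaryGroup (Fin 2) ℂ))
    [MeasureTheory.IsProbabilityMeasure ν]
    (hν : ∀ ψ : PureState 2, IsStateDesign k (stateDistribution ν ψ)) :
    IsUnitaryDesign k ν := by
  have horbit : ∀ n ≤ k, ∀ (r s : Fin 2) {i q : ℕ}, i ≤ n → q ≤ n →
      haarDiscrepancy ν (unitaryEntry r 0 ^ (n - i) * unitaryEntry r 1 ^ i *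
        (star (unitaryEntry 0 s) ^ q * star (unitaryEntry 1 s) ^ (n - q))) = 0 := fun n hn =>
    map_unitaryEntry_pow_mul_star_eq_zero _ (haarDiscrepancy_orbit_eq_zero hn ν
      (haarDiscrepancy_orbit_eq_zero_of_isStateDesign ν hν))
  -- Conjugating column `s` gives the other column `s'`, reversed and scaled by `δ`; `ε` and `ε'`
  -- are the adjugate signs.
  have hmem : ∀ n ≤ k, ∀ (r s s' : Fin 2) (ε ε' : ℂ) {i q : ℕ}, ε * ε = 1 → ε' * ε' = 1 →
      star (unitaryEntry 0 s) = ε • (conjDet * unitaryEntry 1 s') →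
      star (unitaryEntry 1 s) = ε' • (conjDet * unitaryEntry 0 s') → i ≤ n → q ≤ n →
      conjDet ^ n * (unitaryEntry r 0 ^ (n - i) * unitaryEntry r 1 ^ i *
        (unitaryEntry 1 s' ^ q * unitaryEntry 0 s' ^ (n - q))) ∈
          LinearMap.ker (haarDiscrepancy ν) := by
    intro n hn r s s' ε ε' i q hε hε' h0 h1 hi hq
    have h0' : conjDet * unitaryEntry 1 s' = ε • star (unitaryEntry 0 s) := by
      rw [h0, smul_smul, hε, one_smul]
    have h1' : conjDet * unitaryEntry 0 s' = ε' • star (unitaryEntry 1 s) := by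
      rw [h1, smul_smul, hε', one_smul]
    have heq : conjDet ^ n * (unitaryEntry r 0 ^ (n - i) * unitaryEntry r 1 ^ i *
        (unitaryEntry 1 s' ^ q * unitaryEntry 0 s' ^ (n - q))) =
        (ε ^ q * ε' ^ (n - q)) • (unitaryEntry r 0 ^ (n - i) * unitaryEntry r 1 ^ i *
        (star (unitaryEntry 0 s) ^ q * star (unitaryEntry 1 s) ^ (n - q))) := by
      rw [← mul_smul_comm, ← smul_mul_smul_comm, ← smul_pow, ← smul_pow, ← h0', ← h1',
        mul_pow, mul_pow]
      nth_rewrite 1 [← Nat.add_sub_cancel' hq]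
      ring
    rw [LinearMap.mem_ker, heq, map_smul, horbit n hn r s hi hq, smul_zero]
  have hs0 : ∀ n ≤ k, ∀ (r : Fin 2) {i q : ℕ}, i ≤ n → q ≤ n → _ := fun n hn r i q =>
    hmem n hn r 0 1 1 (-1) (i := i) (q := q) (by norm_num) (by norm_num)
      (by rw [one_smul]; exact star_unitaryEntry_zero_zero)
      (by rw [neg_one_smul]; exact star_unitaryEntry_one_zero)
  have hs1 : ∀ n ≤ k, ∀ (r : Fin 2) {i q : ℕ}, i ≤ n → q ≤ n → _ := fun n hn r i q =>
    hmem n hn r 1 0 (-1) 1 (i := i) (q := q) (by norm_num) (by norm_num)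
      (by rw [neg_one_smul]; exact star_unitaryEntry_zero_one)
      (by rw [one_smul]; exact star_unitaryEntry_one_one)
  have hmono := monomial_mem_of_extremal_mem (LinearMap.ker (haarDiscrepancy ν)) conjDet_mul_det k
    (fun n i q hn hi hq => hs0 n hn 1 hi hq) (fun n i q hn hi hq => hs1 n hn 1 hi hq)
    (fun n i q hn hi hq => hs0 n hn 0 hi hq) (fun n i q hn hi hq => hs1 n hn 0 hi hq) k le_rfl
  ext i j
  obtain ⟨t, e₁, e₂, e₃, e₄, he, hprod⟩ := exists_prod_eq_smul_conjDet_pow_mul i j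
  have h : haarDiscrepancy ν
      (∏ l, star (unitaryEntry (i l).1 (j l).1) * unitaryEntry (i l).2 (j l).2) = 0 := by
    rw [hprod, map_smul, LinearMap.mem_ker.1 (hmono e₁ e₂ e₃ e₄ he), smul_zero]
  have hentry : ∀ μ : Measure (unitaryGroup (Fin 2) ℂ),
      matrixExpectation μ (fun U => tensorPowConj (U : Matrix (Fin 2) (Fin 2) ℂ) k) i j =
        ∫ U, (∏ l, star (unitaryEntry (i l).1 (j l).1) * unitaryEntry (i l).2 (j l).2) U ∂μ := by
    intro μ
    simp [matrixExpectation, tensorPowConj, tensorPow, unitaryEntry, ContinuousMap.prod_apply,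
      kroneckerMap_apply]
  rw [hentry, hentry]
  exact sub_eq_zero.1 h
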